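/- A mixed graph $M_G$ is obtained from a finite simple graph $G$ (its underlying graph) by orienting the edges of some subset of $E(G)$. Let $\omega=\frac{1+\mathbf i\sqrt3}{2}$. The $N$-matrix $N(M_G)=(n_{st})$ is the matrix indexed by the vertices with $n_{st}=\omega$ if there is an arc from $s$ to $t$, $n_{st}=\bar\omega$ if there is an arc from $t$ to $s$, $n_{st}=1$ if $st$ is an undirected edge, and $n_{st}=0$ otherwise. Put $P_{M_G}(x)=\det(xI-N(M_G))$ (the polynomial $1$ if there are no vertices). Deleting vertices or an edge keeps the orientations of the remaining edges. A mixed cycle $Z$ of $M_G$ is a mixed subgraph whose underlying graph is a cycle $v_1v_2\cdots v_lv_1$ with $l\ge 3$ distinct vertices; its weight in this direction is $wt(Z)=n_{v_1v_2}n_{v_2v_3}\cdots n_{v_{l-1}v_l}n_{v_lv_1}$. For every mixed cycle $Z$, let $wt(Z)$ be its weight in an arbitrarily chosen one of its two directions. Write $u\sim v$ if $u,v$ are adjacent in $G$. Then: (1) For every vertex $u$ of $M_G$, $$P_{M_G}(x)=xP_{M_G-u}(x)-\sum_{v\sim u}P_{M_G-v-u}(x)-\sum_{Z\in\mathscr C(u)}\left(wt(Z)+\overline{wt(Z)}\right)P_{M_G-V(Z)}(x),$$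 where $\mathscr C(u)$ is the set of mixed cycles of $M_G$ that contain $u$. (2) For every edge $uv$ of $M_G$, oriented or not, $$P_{M_G}(x)=P_{M_G-uv}(x)-P_{M_G-v-u}(x)-\sum_{Z\in\mathscr C(uv)}\left(wt(Z)+\overline{wt(Z)}\right)P_{M_G-V(Z)}(x),$$ where $\mathscr C(uv)$ is the set of mixed cycles of $M_G$ that contain the edge $uv$. -/

import Mathlib

open Polynomial ComplexConjugate

/-- A mixed graph: a simple graph (the underlying graph) some of whose edges are oriented.
`arc u v` says that the edge `uv` is oriented from `u` to `v`; every edge has at most one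
orientation, and an edge without an orientation is an undirected edge. -/
structure MixedGraph (V : Type*) where
  /-- the underlying graph -/
  graph : SimpleGraph V
  /-- `arc u v`: there is an arc from `u` to `v` -/
  arc : V → V → Prop
  adj_of_arc : ∀ u v, arc u v → graph.Adj u v
  arc_asymm : ∀ u v, arc u v → ¬ arc v u

namespace MixedGraph

/-- The sixth root of unity `ω = (1 + i√3) / 2`. -/
noncomputable def omega : ℂ := (1 + Complex.I * (Real.sqrt 3 : ℝ)) / 2

variable {V : Type*}

open scoped Classical in
/-- The Hermitian adjacency matrix of the second kind (the `N`-matrix) of a mixed graph. -/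
noncomputable def nMatrix (M : MixedGraph V) : Matrix V V ℂ :=
  Matrix.of fun s t =>
    if M.arc s t then omega
    else if M.arc t s then conj omega
    else if M.graph.Adj s t then 1
    else 0

open scoped Classical in
/-- The characteristic polynomial `det (x I - N(M))` of a finite mixed graph `M`. -/
noncomputable def charPoly [Finite V] (M : MixedGraph V) : ℂ[X] :=
  letI : Fintype V := Fintype.ofFinite V
  M.nMatrix.charpoly

/-- The mixed graph `M - S` obtained by deleting all vertices in `S`. -/
def deleteVerts (M : MixedGraph V) (S : Set V) : MixedGraph ↥Sᶜ where
  graph := M.graph.induce Sᶜ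
  arc a b := M.arc a b
  adj_of_arc a b h := M.adj_of_arc a b h
  arc_asymm a b h := M.arc_asymm a b h

/-- The mixed graph `M - uv` obtained by deleting the (oriented or unoriented) edge `uv`. -/
def deleteEdge (M : MixedGraph V) (u v : V) : MixedGraph V where
  graph := M.graph.deleteEdges {s(u, v)}
  arc a b := M.arc a b ∧ s(a, b) ≠ s(u, v)
  adj_of_arc a b h := by
    rw [SimpleGraph.deleteEdges_adj]
    exact ⟨M.adj_of_arc a b h.1, h.2⟩
  arc_asymm a b h h' := M.arc_asymm a b h.1 h'.1

/-- The product `n_{12} n_{23} ⋯ n_{l1}` of the entries of the `N`-matrix along a closed walk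
`v₁ v₂ ⋯ v_l v₁`. -/
noncomputable def walkWeight (M : MixedGraph V) {v : V} (p : M.graph.Walk v v) : ℂ :=
  (p.darts.map fun d => M.nMatrix d.fst d.snd).prod

/-- A mixed subgraph of `M` inherits its orientations from `M`, so it is given by a subgraph `Z` of
the underlying graph. It is a mixed cycle of `M` if `Z` is a cycle, that is, if `Z` consists of the
vertices and edges of a closed walk that repeats no vertex and has length at least three.
Being a subgraph, a cycle carries neither a base point nor a direction. -/
def IsMixedCycle (M : MixedGraph V) (Z : M.graph.Subgraph) : Prop :=
  ∃ (v : V) (p : M.graph.Walk v v), p.IsCycle ∧ p.toSubgraph = Z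

/-- `α` is the weight of the mixed cycle `Z` in one of its two directions. -/
def IsWeight (M : MixedGraph V) (Z : M.graph.Subgraph) (α : ℂ) : Prop :=
  ∃ (v : V) (p : M.graph.Walk v v), p.IsCycle ∧ p.toSubgraph = Z ∧ M.walkWeight p = α

/-- The set of mixed cycles of `M` that contain the vertex `u`. -/
noncomputable def cyclesAt [Finite V] (M : MixedGraph V) (u : V) : Finset M.graph.Subgraph :=
  (Set.toFinite {Z : M.graph.Subgraph | M.IsMixedCycle Z ∧ u ∈ Z.verts}).toFinset

/-- The set of mixed cycles of `M` that contain the edge `uv`. -/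
noncomputable def cyclesThrough [Finite V] (M : MixedGraph V) (u v : V) :
    Finset M.graph.Subgraph :=
  (Set.toFinite {Z : M.graph.Subgraph | M.IsMixedCycle Z ∧ Z.Adj u v}).toFinset

/-- The set of neighbours of `u` in the underlying graph. -/
noncomputable def neighbours [Finite V] (M : MixedGraph V) (u : V) : Finset V :=
  (Set.toFinite {v : V | M.graph.Adj u v}).toFinset

end MixedGraph

/-! Group the Leibniz terms of `det (xI - N)` by the cycle `c` of the permutation through `u`. The
remaining factor is a permutation of the vertices off `c`, so each group sums to the signed product
along `c` times a principal minor (`det_eq_sum_cycles`). A cycle of length `l` has sign `(-1)^(l-1)`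
and `l` entries `-n_{st}`, hence contributes minus its weight. Fixing `u` gives the factor `x`. A
transposition has weight `n_{uv} n_{vu} = 1` on an edge, since `|ω| = 1`. Longer cycles with nonzero
weight run along mixed cycles, each arising from exactly one pair `c`, `c⁻¹` with conjugate weights
(`sum_cyclePerm_eq_sum_mixedCycle`). This is (1).

For (2), expand both `M` and `M - uv` at `u` and subtract: every minor omits `u`, so it is the same
for both graphs, and only the cycles using `uv` survive. -/

/-! ### Expansion of a determinant by the cycle through a point -/

section DetExpansion

open Equiv.Perm
open scoped Classical

/-- The minor of `A` obtained by deleting the rows and columns indexed by `S`. -/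
noncomputable def complMinor {V R : Type*} [Fintype V] [CommRing R] (A : Matrix V V R)
    (S : Set V) : R :=
  (A.submatrix (Subtype.val : ↥Sᶜ → V) Subtype.val).det

theorem disjoint_ofSubtype_compl {V : Type*} {S : Set V} [DecidablePred (· ∈ Sᶜ)] {c : Equiv.Perm V} (hc : ∀ x ∉ S, c x = x)
    (τ : Equiv.Perm ↥Sᶜ) : Disjoint c (ofSubtype τ) := by
  intro x
  by_cases hx : x ∈ S
  · exact Or.inr (ofSubtype_apply_of_not_mem τ (by simpa using hx))
  · exact Or.inl (hc x hx)

variable {V R : Type*} [Fintype V] [CommRing R]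

theorem complMinor_eq_det (A : Matrix V V R) (S : Set V) [Fintype ↥Sᶜ] [DecidableEq ↥Sᶜ] :
    complMinor A S = (A.submatrix (Subtype.val : ↥Sᶜ → V) Subtype.val).det := by
  unfold complMinor
  congr!

theorem prod_mul_ofSubtype (A : Matrix V V R) {S : Finset V} {c : Equiv.Perm V}
    (hc : ∀ x ∉ S, c x = x) (τ : Equiv.Perm ↥(S : Set V)ᶜ) :
    ∏ i, A i ((c * ofSubtype τ) i)
      = (∏ i ∈ S, A i (c i)) * ∏ i : ↥(S : Set V)ᶜ, A i (τ i) := by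
  rw [← Finset.prod_mul_prod_compl S]
  congr 1
  · refine Finset.prod_congr rfl fun i hi => ?_
    rw [mul_apply, ofSubtype_apply_of_not_mem τ (by simpa using hi)]
  · rw [← Finset.prod_coe_sort]
    refine Fintype.prod_equiv (Equiv.subtypeEquivRight fun x => by simp) _ _ fun i => ?_
    obtain ⟨i, hi⟩ := i
    have hi' : i ∈ (S : Set V)ᶜ := by simpa using hi
    have h := ofSubtype_apply_of_mem τ hi'
    simp only [mul_apply, h, Equiv.subtypeEquivRight_apply_coe]
    have h' : (τ ⟨i, hi'⟩ : V) ∉ S := fun h' => (τ ⟨i, hi'⟩).2 h'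
    rw [hc _ h']
    rfl

/-- The permutations in the fiber are exactly `c * ofSubtype τ` with `τ` an arbitrary permutation of
the complement of `S`. Adding `u` to the moved points makes `S = {u}` when `c = 1`, covering the
case where `u` is fixed. -/
theorem sum_fiber_cycleOf (A : Matrix V V R) (u : V) {c : Equiv.Perm V}
    (hc : c = 1 ∨ c.IsCycle ∧ c u ≠ u) {S : Finset V} (hS : ∀ i, i ∈ S ↔ i = u ∨ c i ≠ i) :
    ∑ σ : Equiv.Perm V with σ.cycleOf u = c, ((sign σ : ℤ) : R) * ∏ i, A i (σ i)
      = ((sign c : ℤ) : R) * (∏ i ∈ S, A i (c i)) * complMinor A (S : Set V) := by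
  have hcS : ∀ x ∉ S, c x = x := fun x hx => by
    by_contra h
    exact hx ((hS x).2 (Or.inr h))
  have huS : u ∈ S := (hS u).2 (Or.inl rfl)
  have hcu : c.cycleOf u = c := by
    rcases hc with rfl | ⟨h1, h2⟩
    · simp
    · exact h1.cycleOf_eq h2
  have hmem : ∀ τ : Equiv.Perm ↥(S : Set V)ᶜ, (c * ofSubtype τ).cycleOf u = c := fun τ => by
    rw [cycleOf_mul_of_apply_right_eq_self (disjoint_ofSubtype_compl (S := (S : Set V)) hcS τ).commute, hcu]
    exact ofSubtype_apply_of_not_mem τ (by simpa using huS)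
  -- The Leibniz formula `det_apply'` has entries `A (σ i) i`; transposing turns them into `A i (σ
  -- i)`.
  rw [complMinor_eq_det, ← Matrix.det_transpose, Matrix.det_apply', Finset.mul_sum]
  symm
  refine Finset.sum_bij (fun τ _ => c * ofSubtype τ) ?_ ?_ ?_ ?_
  · intro τ _
    simpa using hmem τ
  · intro τ _ τ' _ h
    exact ofSubtype_injective (mul_left_cancel h)
  · intro σ hσ
    have hσc : σ.cycleOf u = c := by simpa using hσ
    have hSeq : ∀ x ∈ S, σ x = c x := by
      intro x hx
      have hs : SameCycle σ u x := by
        rcases (hS x).1 hx with rfl | hx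
        · exact SameCycle.refl _ _
        · rw [← hσc] at hx
          by_contra h
          exact hx (cycleOf_apply_of_not_sameCycle h)
      rw [← hσc, hs.cycleOf_apply]
    have hfix : ∀ x, (c⁻¹ * σ) x ≠ x → x ∈ (S : Set V)ᶜ := by
      intro x hx hxS
      exact hx (by rw [mul_apply, hSeq x hxS]; simp)
    have hst : ∀ x, x ∈ (S : Set V)ᶜ ↔ (c⁻¹ * σ) x ∈ (S : Set V)ᶜ := by
      intro x
      by_cases h : (c⁻¹ * σ) x = x
      · rw [h]
      · exact iff_of_true (hfix x h) (hfix _ fun h' => h ((c⁻¹ * σ).injective h'))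
    refine ⟨(c⁻¹ * σ).subtypePerm fun x => (hst x).symm, Finset.mem_univ _, ?_⟩
    rw [ofSubtype_subtypePerm _ hfix]
    simp
  · intro τ _
    rw [prod_mul_ofSubtype A hcS, Equiv.Perm.sign_mul, sign_ofSubtype]
    simp only [Matrix.transpose_apply, Matrix.submatrix_apply]
    push_cast
    ring

/-- Expansion of a determinant along the cycle through `u` of each permutation. -/
theorem det_eq_sum_cycles (A : Matrix V V R) (u : V) :
    A.det = A u u * complMinor A {u}
      + ∑ c : Equiv.Perm V with c.IsCycle ∧ c u ≠ u,
          ((sign c : ℤ) : R) * (∏ i ∈ c.support, A i (c i))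
            * complMinor A (c.support : Set V) := by
  have h1 : A.det = ∑ σ : Equiv.Perm V, ((sign σ : ℤ) : R) * ∏ i, A i (σ i) := by
    rw [← Matrix.det_transpose, Matrix.det_apply']
    rfl
  have hmaps : ∀ σ ∈ (Finset.univ : Finset (Equiv.Perm V)), σ.cycleOf u ∈
      insert 1 ({c : Equiv.Perm V | c.IsCycle ∧ c u ≠ u} : Finset (Equiv.Perm V)) := by
    intro σ _
    by_cases h : σ u = u
    · simp [(cycleOf_eq_one_iff σ).2 h]
    · simp [isCycle_cycleOf σ h, h]
  rw [h1, ← Finset.sum_fiberwise_of_maps_to hmaps, Finset.sum_insert (by simp),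
    sum_fiber_cycleOf A u (Or.inl rfl) (S := {u}) (by simp)]
  congr 1
  · simp
  · refine Finset.sum_congr rfl fun c hc => ?_
    have hc' : c.IsCycle ∧ c u ≠ u := by simpa using hc
    refine sum_fiber_cycleOf A u (Or.inr hc') fun i => ?_
    rw [mem_support, eq_comm, or_iff_right_of_imp]
    rintro rfl
    exact hc'.2

end DetExpansion

/-! ### Cyclic permutations and graph cycles -/

section CyclePerm

open Equiv.Perm
open scoped Classical

variable {V : Type*}

/-- The subgraph of `G` formed by the edges `{x, c x}` on the points moved by `c`. -/
def SimpleGraph.permSubgraph (G : SimpleGraph V) (c : Equiv.Perm V) : G.Subgraph where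
  verts := {x | c x ≠ x}
  Adj a b := G.Adj a b ∧ (c a = b ∨ c b = a)
  adj_sub h := h.1
  edge_vert := by
    rintro a b ⟨h, h' | h'⟩
    · exact fun h'' => h.ne (h''.symm.trans h')
    · intro h''
      exact h.ne (c.injective (h''.trans h'.symm))
  symm := ⟨fun _ _ h => ⟨h.1.symm, h.2.symm⟩⟩

/-- Such a cycle is a transposition. Thus `c⁻¹ ≠ c` encodes length at least three. -/
theorem Equiv.Perm.IsCycle.inv_eq_of_apply_apply_eq {c : Equiv.Perm V} (hc : c.IsCycle) {x : V}
    (hx : c x ≠ x) (h : c (c x) = x) : c⁻¹ = c := by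
  rw [hc.eq_swap_of_apply_apply_eq_self hx h, Equiv.swap_inv]

namespace SimpleGraph

variable {G : SimpleGraph V}

/-- The closed walk `p` runs once through the points moved by `c`, following `c`. -/
def Walk.Follows {v : V} (p : G.Walk v v) (c : Equiv.Perm V) : Prop :=
  (∀ d ∈ p.darts, d.snd = c d.fst) ∧ ∀ x, x ∈ p.support ↔ c x ≠ x

theorem permSubgraph_inv (c : Equiv.Perm V) : G.permSubgraph c⁻¹ = G.permSubgraph c := by
  ext a b
  · simp only [permSubgraph, Set.mem_ofPred_eq, ne_eq, inv_eq_iff_eq]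
    rw [eq_comm]
  · simp only [permSubgraph, inv_eq_iff_eq]
    tauto

theorem Walk.IsCycle.mem_map_fst_darts {v : V} {p : G.Walk v v} (hp : p.IsCycle) {x : V} :
    x ∈ p.darts.map (·.fst) ↔ x ∈ p.support := by
  rw [p.map_fst_darts, ← p.tail_support_perm_dropLast_support.mem_iff]
  refine ⟨List.mem_of_mem_tail, fun h => ?_⟩
  rw [Walk.mem_support_iff] at h
  rcases h with rfl | h
  · exact p.end_mem_tail_support hp.not_nil
  · exact h

theorem Walk.Follows.toSubgraph_eq {v : V} {p : G.Walk v v} {c : Equiv.Perm V}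
    (hp : p.IsCycle) (h : p.Follows c) : p.toSubgraph = G.permSubgraph c := by
  have key : ∀ a b, G.Adj a b → c a = b → s(a, b) ∈ p.edges := by
    intro a b hab hc
    have ha : a ∈ p.darts.map (·.fst) := by
      rw [hp.mem_map_fst_darts, h.2, hc]
      exact hab.ne'
    obtain ⟨d, hd, rfl⟩ := List.mem_map.1 ha
    refine List.mem_map.2 ⟨d, hd, ?_⟩
    rw [← hc, ← h.1 d hd]
    rfl
  ext a b
  · rw [Walk.mem_verts_toSubgraph]
    exact h.2 a
  · rw [Walk.adj_toSubgraph_iff_mem_edges]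
    constructor
    · intro hab
      refine ⟨p.adj_of_mem_edges hab, ?_⟩
      obtain ⟨d, hd, he⟩ := List.mem_map.1 hab
      have := h.1 d hd
      rcases (SimpleGraph.dart_edge_eq_mk'_iff' ).1 he with ⟨rfl, rfl⟩ | ⟨rfl, rfl⟩
      · exact Or.inl this.symm
      · exact Or.inr this.symm
    · rintro ⟨hab, hc | hc⟩
      · exact key a b hab hc
      · rw [Sym2.eq_swap]
        exact key b a hab.symm hc

theorem Walk.Follows.prod_darts [Fintype V] {R : Type*} [CommMonoid R] {v : V} {p : G.Walk v v}
    {c : Equiv.Perm V} (hp : p.IsCycle) (h : p.Follows c) (f : V → V → R) :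
    (p.darts.map fun d => f d.fst d.snd).prod = ∏ x ∈ c.support, f x (c x) := by
  have h1 : (p.darts.map fun d => f d.fst d.snd)
      = (p.darts.map (·.fst)).map fun x => f x (c x) := by
    rw [List.map_map]
    refine List.map_congr_left fun d hd => ?_
    simp [h.1 d hd]
  have hnd : (p.darts.map (·.fst)).Nodup := by
    rw [p.map_fst_darts]
    exact hp.nodup_dropLast_support
  rw [h1, ← List.prod_toFinset _ hnd]
  refine Finset.prod_congr ?_ fun _ _ => rfl
  ext x
  rw [List.mem_toFinset, hp.mem_map_fst_darts, h.2, Equiv.Perm.mem_support]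

theorem exists_walk_iterate (c : Equiv.Perm V) (hadj : ∀ x, c x ≠ x → G.Adj x (c x)) (k : ℕ) :
    ∀ x, c x ≠ x → ∃ p : G.Walk x (c^[k] x),
      p.support = List.iterate c x (k + 1) ∧ ∀ d ∈ p.darts, d.snd = c d.fst := by
  induction k with
  | zero => exact fun x _ => ⟨Walk.nil, by simp, by simp⟩
  | succ k ih =>
    intro x hx
    obtain ⟨p, hp, hd⟩ := ih (c x) (fun h => hx (c.injective h))
    rw [Function.iterate_succ_apply]
    refine ⟨Walk.cons (hadj x hx) p, ?_, ?_⟩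
    · rw [Walk.support_cons, hp]
      rfl
    · intro d hd'
      rw [Walk.darts_cons, List.mem_cons] at hd'
      rcases hd' with rfl | hd'
      · rfl
      · exact hd d hd'

/-- Iterating `c` from `c u` gives a path ending at `u`; the edge from `u` to `c u` closes it. -/
theorem exists_isCycle_follows [Finite V] {c : Equiv.Perm V} (hc : c.IsCycle) (hinv : c⁻¹ ≠ c)
    (hadj : ∀ x, c x ≠ x → G.Adj x (c x)) :
    ∃ (v : V) (p : G.Walk v v), p.IsCycle ∧ p.Follows c := by
  have := Fintype.ofFinite V
  obtain ⟨u, hu, -⟩ := id hc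
  have hon : c.IsCycleOn (c.support : Set V) := by
    convert hc.isCycleOn using 1
    ext
    simp
  have hus : c u ∈ c.support := by simpa using hu
  obtain ⟨k, hk⟩ : ∃ k, c.support.card = k + 1 :=
    Nat.exists_eq_succ_of_ne_zero (Finset.card_pos.2 ⟨_, hus⟩).ne'
  have hend : c^[k] (c u) = u := by
    have := hon.pow_card_apply (a := u) (by simpa using hu)
    rwa [hk, ← iterate_eq_pow, Function.iterate_succ_apply] at this
  obtain ⟨p, hp, hd⟩ := exists_walk_iterate c hadj k (c u) (fun h => hu (c.injective h))
  have hnd : p.support.Nodup := by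
    rw [hp, List.nodup_iff_injective_getElem]
    rintro ⟨i, hi⟩ ⟨j, hj⟩ hij
    simp only [List.getElem_iterate, iterate_eq_pow, hon.pow_apply_eq_pow_apply hus] at hij
    rw [List.length_iterate, ← hk] at hi hj
    exact Fin.ext (hij.eq_of_lt_of_lt hi hj)
  generalize hw : c^[k] (c u) = w at p hend
  subst hend
  have hcyc : (Walk.cons (hadj w hu) p).IsCycle := by
    rw [Walk.cons_isCycle_iff]
    refine ⟨(Walk.isPath_def p).2 hnd, fun he => ?_⟩
    obtain ⟨d, hdp, hde⟩ := List.mem_map.1 he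
    have hds := hd d hdp
    -- If the path already used the closing edge, it would either leave its last vertex `w`,
    -- repeating a vertex, or step from `c w` to `w`, making `c` an involution.
    rcases SimpleGraph.dart_edge_eq_mk'_iff'.1 hde with ⟨h1, h2⟩ | ⟨h1, h2⟩
    · rw [← p.map_fst_darts_append, List.nodup_append] at hnd
      exact hnd.2.2 _ (List.mem_map_of_mem hdp) w (by simp) h1
    · rw [h1, h2] at hds
      exact hinv (hc.inv_eq_of_apply_apply_eq hu hds.symm)
  refine ⟨w, _, hcyc, ?_, ?_⟩
  · intro d hd'
    rw [Walk.darts_cons, List.mem_cons] at hd'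
    rcases hd' with rfl | hd'
    · rfl
    · exact hd d hd'
  · intro x
    rw [Walk.support_cons, List.mem_cons, or_iff_right_of_imp (by rintro rfl; simp), hp,
      List.mem_iterate]
    constructor
    · rintro ⟨m, -, rfl⟩
      rw [← Equiv.Perm.mem_support, iterate_eq_pow]
      simpa using hu
    · intro hx
      obtain ⟨m, hm, rfl⟩ := hon.exists_pow_eq hus (by simpa using hx)
      exact ⟨m, hk ▸ hm, by rw [iterate_eq_pow]⟩

/-- The permutation is `formPerm` of the support without its head, because the base point occurs at
both ends of the support. -/
theorem Walk.IsCycle.exists_follows {v : V} {p : G.Walk v v} (hp : p.IsCycle) :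
    ∃ c : Equiv.Perm V, c.IsCycle ∧ c⁻¹ ≠ c ∧ p.Follows c := by
  have hlen := hp.three_le_length
  have hnd := hp.support_nodup
  have hll : p.support.tail.length = p.length := by simp
  have h0 : p.support.tail.formPerm p.support.tail[0] = p.support.tail[1] :=
    List.formPerm_apply_lt_getElem _ hnd 0 (by omega)
  have h1 : p.support.tail.formPerm p.support.tail[1] = p.support.tail[2] :=
    List.formPerm_apply_lt_getElem _ hnd 1 (by omega)
  refine ⟨p.support.tail.formPerm, List.isCycle_formPerm hnd (by omega), ?_, ?_, ?_⟩
  · intro h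
    rw [inv_eq_iff_mul_eq_one] at h
    have := congrArg (· p.support.tail[0]) h
    simp only [mul_apply, h0, h1, one_apply] at this
    have := (hnd.getElem_inj_iff).1 this
    omega
  · intro d hd
    obtain ⟨i, hi, rfl⟩ := List.getElem_of_mem hd
    have hi' : i < p.length := by simpa using hi
    rw [snd_darts_getElem, fst_darts_getElem, List.getElem_dropLast]
    -- The first dart leaves the base point, which is the last entry of the tail, so there
    -- `formPerm` wraps around.
    rcases i with _ | i
    · have : p.support[0] = p.support.tail[p.length - 1] := by
        rw [List.getElem_tail]
        simp only [show p.length - 1 + 1 = p.length by omega, support_getElem_length,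
          support_getElem_zero]
      rw [this, List.formPerm_apply_getElem _ hnd]
      simp [show p.length - 1 + 1 = p.length by omega]
    · have : p.support[i + 1]'(by rw [p.length_support]; omega) = p.support.tail[i] :=
        (List.getElem_tail _).symm
      rw [this, List.formPerm_apply_lt_getElem _ hnd]
  · intro x
    have := congrArg (x ∈ ·) (List.support_formPerm_of_nodup' _ hnd fun x hx => by
      rw [hx] at hll; simp at hll; omega)
    simp only [Set.mem_ofPred_eq, Finset.mem_coe, List.mem_toFinset, eq_iff_iff] at this
    rw [this, Walk.mem_support_iff]
    exact or_iff_right_of_imp (by rintro rfl; exact p.end_mem_tail_support hp.not_nil)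

/-- Agreement propagates along the cycle: from `c y` the only neighbours in the subgraph are `c (c
y)` and `y`, and `c'` cannot turn back to `y` without being a transposition. -/
theorem eq_of_permSubgraph_eq_of_apply_eq [Finite V] {c c' : Equiv.Perm V} (hc : c.IsCycle)
    (hc' : c'.IsCycle) (hinv' : c'⁻¹ ≠ c') (hadj' : ∀ x, c' x ≠ x → G.Adj x (c' x))
    (h : G.permSubgraph c' = G.permSubgraph c) {u : V} (hu : c u ≠ u) (huu : c' u = c u) :
    c' = c := by
  have hv : ∀ x, c' x ≠ x ↔ c x ≠ x := fun x =>
    iff_of_eq (congrArg (fun Z : G.Subgraph => x ∈ Z.verts) h)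
  have hstep : ∀ y, c y ≠ y → c' y = c y → c' (c y) = c (c y) := by
    intro y hy hyy
    have hcy : c' (c y) ≠ c y := (hv _).2 fun h => hy (c.injective h)
    have hA : (G.permSubgraph c').Adj (c y) (c' (c y)) := ⟨hadj' _ hcy, Or.inl rfl⟩
    rw [h] at hA
    rcases hA.2 with h1 | h1
    · exact h1.symm
    · have h2 : c' (c' y) = y := by
        rw [hyy]
        exact c.injective h1
      exact absurd (hc'.inv_eq_of_apply_apply_eq ((hv y).2 hy) h2) hinv'
  have hpow : ∀ k : ℕ, c' ((c ^ k) u) = c ((c ^ k) u) := by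
    intro k
    induction k with
    | zero => exact huu
    | succ k ih =>
      rw [pow_succ', mul_apply]
      refine hstep _ (fun h => hu ?_) ih
      exact (c ^ k).injective (by rw [← mul_apply, ← pow_succ, pow_succ', mul_apply, h])
  ext x
  by_cases hx : c x = x
  · rw [hx]
    by_contra h'
    exact (hv x).1 h' hx
  · obtain ⟨k, rfl⟩ := hc.exists_pow_eq hu hx
    exact hpow k

theorem permSubgraph_eq_iff [Finite V] {c c' : Equiv.Perm V} (hc : c.IsCycle)
    (hc' : c'.IsCycle) (hinv' : c'⁻¹ ≠ c') (hadj' : ∀ x, c' x ≠ x → G.Adj x (c' x)) :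
    G.permSubgraph c' = G.permSubgraph c ↔ c' = c ∨ c' = c⁻¹ := by
  constructor
  · intro h
    obtain ⟨u, hu, -⟩ := id hc'
    have hA : (G.permSubgraph c').Adj u (c' u) := ⟨hadj' _ hu, Or.inl rfl⟩
    have hu' : u ∈ (G.permSubgraph c).verts := h ▸ hu
    rw [h] at hA
    rcases hA.2 with h1 | h1
    · exact Or.inl (eq_of_permSubgraph_eq_of_apply_eq hc hc' hinv' hadj' h hu' h1.symm)
    · refine Or.inr (eq_of_permSubgraph_eq_of_apply_eq hc.inv hc' hinv' hadj'
        (by rw [h, permSubgraph_inv]) (u := u) ?_ ?_)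
      · rw [Ne, inv_eq_iff_eq]
        exact fun h => hu' h.symm
      · rw [eq_inv_iff_eq]
        exact h1
  · rintro (rfl | rfl)
    · rfl
    · exact permSubgraph_inv c

end SimpleGraph

end CyclePerm

/-! ### Weights of cyclic permutations in the `N`-matrix -/

namespace MixedGraph

open scoped Classical

variable {V : Type*} (M : MixedGraph V)

theorem not_arc_of_not_adj {s t : V} (h : ¬ M.graph.Adj s t) : ¬ M.arc s t :=
  fun h' => h (M.adj_of_arc _ _ h')

theorem nMatrix_eq_zero {s t : V} (h : ¬ M.graph.Adj s t) : M.nMatrix s t = 0 := by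
  have h' : ¬ M.graph.Adj t s := fun h' => h h'.symm
  simp [nMatrix, M.not_arc_of_not_adj h, M.not_arc_of_not_adj h', h]

theorem conj_nMatrix (s t : V) : conj (M.nMatrix s t) = M.nMatrix t s := by
  by_cases h1 : M.arc s t
  · simp [nMatrix, h1, M.arc_asymm _ _ h1]
  · by_cases h2 : M.arc t s
    · simp [nMatrix, h1, h2]
    · by_cases h3 : M.graph.Adj s t
      · simp [nMatrix, h1, h2, h3, h3.symm]
      · rw [M.nMatrix_eq_zero h3, M.nMatrix_eq_zero fun h => h3 h.symm, map_zero]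

theorem omega_mul_conj : omega * conj omega = 1 := by
  have h : ((Real.sqrt 3 : ℝ) : ℂ) ^ 2 = 3 := by
    rw [← Complex.ofReal_pow, Real.sq_sqrt (by norm_num)]
    norm_num
  simp only [omega, map_div₀, map_add, map_one, map_mul, Complex.conj_I, Complex.conj_ofReal,
    map_ofNat]
  linear_combination (-(Complex.I ^ 2) / 4) * h - (3 / 4) * Complex.I_sq

theorem nMatrix_mul_symm {s t : V} (h : M.graph.Adj s t) :
    M.nMatrix s t * M.nMatrix t s = 1 := by
  rw [← M.conj_nMatrix s t]
  by_cases h1 : M.arc s t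
  · simp [nMatrix, h1, omega_mul_conj]
  · by_cases h2 : M.arc t s
    · simp [nMatrix, h1, h2, mul_comm, omega_mul_conj]
    · simp [nMatrix, h1, h2, h]

theorem nMatrix_deleteEdge (u v s t : V) :
    (M.deleteEdge u v).nMatrix s t = if s(s, t) = s(u, v) then 0 else M.nMatrix s t := by
  split_ifs with h
  · apply nMatrix_eq_zero
    simp [deleteEdge, h]
  · have h' : s(t, s) ≠ s(u, v) := by rwa [Sym2.eq_swap]
    simp only [nMatrix, deleteEdge, Matrix.of_apply, ne_eq, h, h', not_false_eq_true, and_true,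
      SimpleGraph.deleteEdges_adj, Set.mem_singleton_iff]

variable [Fintype V]

theorem charmatrix_submatrix_of_injective {m n R : Type*} [Fintype m] [Fintype n]
    [DecidableEq m] [DecidableEq n]
    [CommRing R] (N : Matrix n n R) {f : m → n} (hf : Function.Injective f) :
    (N.submatrix f f).charmatrix = N.charmatrix.submatrix f f := by
  ext1 i j
  by_cases h : i = j
  · rw [h, Matrix.submatrix_apply, Matrix.charmatrix_apply_eq, Matrix.charmatrix_apply_eq,
      Matrix.submatrix_apply]
  · rw [Matrix.submatrix_apply, Matrix.charmatrix_apply_ne _ _ _ h,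
      Matrix.charmatrix_apply_ne _ _ _ (hf.ne h), Matrix.submatrix_apply]

theorem charPoly_deleteVerts (S : Set V) :
    (M.deleteVerts S).charPoly = complMinor M.nMatrix.charmatrix S := by
  let _ : Fintype ↥Sᶜ := Fintype.ofFinite ↥Sᶜ
  have hN : (M.deleteVerts S).nMatrix = M.nMatrix.submatrix Subtype.val Subtype.val := rfl
  rw [complMinor_eq_det, ← charmatrix_submatrix_of_injective _ Subtype.val_injective, ← hN]
  unfold charPoly Matrix.charpoly
  congr!

/-- The product of the entries of the `N`-matrix along the points moved by `c`. -/
noncomputable def permWeight (c : Equiv.Perm V) : ℂ := ∏ x ∈ c.support, M.nMatrix x (c x)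

/-- The `N`-matrix is Hermitian; reindex the product by `c`. -/
theorem permWeight_inv (c : Equiv.Perm V) : M.permWeight c⁻¹ = conj (M.permWeight c) := by
  rw [permWeight, permWeight, map_prod, Equiv.Perm.support_inv]
  symm
  refine Finset.prod_bij (fun x _ => c x) (by simp) (by simp) ?_ ?_
  · intro y hy
    refine ⟨c⁻¹ y, ?_, by simp⟩
    rw [Equiv.Perm.mem_support] at hy ⊢
    intro h
    have hy' : c (c⁻¹ y) = y := c.apply_symm_apply y
    exact hy (Equiv.Perm.eq_inv_iff_eq.1 (hy'.symm.trans h))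
  · intro x _
    simp [conj_nMatrix]

theorem permWeight_eq_zero {c : Equiv.Perm V} (h : ¬ ∀ x, c x ≠ x → M.graph.Adj x (c x)) :
    M.permWeight c = 0 := by
  push Not at h
  obtain ⟨x, hx, hadj⟩ := h
  exact Finset.prod_eq_zero (Equiv.Perm.mem_support.2 hx) (M.nMatrix_eq_zero hadj)

theorem isMixedCycle_permSubgraph {c : Equiv.Perm V} (hc : c.IsCycle) (hinv : c⁻¹ ≠ c)
    (hadj : ∀ x, c x ≠ x → M.graph.Adj x (c x)) : M.IsMixedCycle (M.graph.permSubgraph c) := by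
  obtain ⟨v, p, hp, hf⟩ := SimpleGraph.exists_isCycle_follows hc hinv hadj
  exact ⟨v, p, hp, hf.toSubgraph_eq hp⟩

theorem IsWeight.exists_perm {Z : M.graph.Subgraph} {α : ℂ} (h : M.IsWeight Z α) :
    ∃ c : Equiv.Perm V, c.IsCycle ∧ c⁻¹ ≠ c ∧ (∀ x, c x ≠ x → M.graph.Adj x (c x)) ∧
      M.graph.permSubgraph c = Z ∧ M.permWeight c = α := by
  obtain ⟨v, p, hp, rfl, rfl⟩ := h
  obtain ⟨c, hc, hinv, hf⟩ := hp.exists_follows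
  refine ⟨c, hc, hinv, ?_, (hf.toSubgraph_eq hp).symm, ?_⟩
  · intro x hx
    obtain ⟨d, hd, rfl⟩ := List.mem_map.1 (hp.mem_map_fst_darts.2 ((hf.2 x).2 hx))
    rw [← hf.1 d hd]
    exact d.adj
  · exact (hf.prod_darts hp M.nMatrix).symm

/-- Sums over cyclic permutations of length at least three are sums over mixed cycles, each mixed
cycle coming from one permutation for each of its two directions. -/
theorem sum_cyclePerm_eq_sum_mixedCycle (wt : M.graph.Subgraph → ℂ)
    (hwt : ∀ Z : M.graph.Subgraph, M.IsMixedCycle Z → M.IsWeight Z (wt Z))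
    (D : Set V → ℂ[X]) (T : Finset M.graph.Subgraph) (q : M.graph.Subgraph → Prop)
    (hT : ∀ Z, Z ∈ T ↔ M.IsMixedCycle Z ∧ q Z) (Q : Equiv.Perm V → Prop)
    (hQ : ∀ c : Equiv.Perm V, (∀ x, c x ≠ x → M.graph.Adj x (c x)) →
      (Q c ↔ q (M.graph.permSubgraph c))) :
    ∑ c : Equiv.Perm V with c.IsCycle ∧ c⁻¹ ≠ c ∧ Q c,
        C (M.permWeight c) * D (c.support : Set V)
      = ∑ Z ∈ T, C (wt Z + conj (wt Z)) * D Z.verts := by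
  have h1 : ∑ c : Equiv.Perm V with c.IsCycle ∧ c⁻¹ ≠ c ∧ Q c,
        C (M.permWeight c) * D (c.support : Set V)
      = ∑ c : Equiv.Perm V with (c.IsCycle ∧ c⁻¹ ≠ c ∧ Q c) ∧
          ∀ x, c x ≠ x → M.graph.Adj x (c x), C (M.permWeight c) * D (c.support : Set V) := by
    rw [← Finset.filter_filter (fun c : Equiv.Perm V => c.IsCycle ∧ c⁻¹ ≠ c ∧ Q c)]
    symm
    refine Finset.sum_filter_of_ne fun c _ hne => ?_
    by_contra h
    exact hne (by rw [M.permWeight_eq_zero h, C_0, zero_mul])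
  have hmaps : ∀ c ∈ ({c : Equiv.Perm V | (c.IsCycle ∧ c⁻¹ ≠ c ∧ Q c) ∧
      ∀ x, c x ≠ x → M.graph.Adj x (c x)} : Finset (Equiv.Perm V)),
      M.graph.permSubgraph c ∈ T := by
    intro c hc
    obtain ⟨⟨hc1, hc2, hc3⟩, hc4⟩ := (Finset.mem_filter.1 hc).2
    exact (hT _).2 ⟨M.isMixedCycle_permSubgraph hc1 hc2 hc4, (hQ c hc4).1 hc3⟩
  rw [h1, ← Finset.sum_fiberwise_of_maps_to hmaps]
  refine Finset.sum_congr rfl fun Z hZ => ?_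
  obtain ⟨hZ1, hZ2⟩ := (hT Z).1 hZ
  obtain ⟨c, hc, hinv, hadj, rfl, hw⟩ := IsWeight.exists_perm M (hwt Z hZ1)
  have hadj' : ∀ x, c⁻¹ x ≠ x → M.graph.Adj x (c⁻¹ x) := by
    intro x hx
    have hcx : c (c⁻¹ x) = x := c.apply_symm_apply x
    have h := hadj (c⁻¹ x) (by rw [hcx]; exact hx.symm)
    rw [hcx] at h
    exact h.symm
  -- Here `c` is the direction whose weight is `wt Z`; the reverse direction supplies the conjugate.
  have hfib : Finset.filter (fun c' => M.graph.permSubgraph c' = M.graph.permSubgraph c)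
      ({c : Equiv.Perm V | (c.IsCycle ∧ c⁻¹ ≠ c ∧ Q c) ∧
        ∀ x, c x ≠ x → M.graph.Adj x (c x)} : Finset (Equiv.Perm V)) = {c, c⁻¹} := by
    ext c'
    simp only [Finset.mem_filter, Finset.mem_univ, true_and, Finset.mem_insert,
      Finset.mem_singleton]
    constructor
    · rintro ⟨⟨⟨h1, h2, -⟩, h3⟩, h4⟩
      exact (SimpleGraph.permSubgraph_eq_iff hc h1 h2 h3).1 h4
    · rintro (rfl | rfl)
      · exact ⟨⟨⟨hc, hinv, (hQ _ hadj).2 hZ2⟩, hadj⟩, rfl⟩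
      · exact ⟨⟨⟨hc.inv, by rw [inv_inv]; exact hinv.symm,
          (hQ _ hadj').2 (by rwa [SimpleGraph.permSubgraph_inv])⟩, hadj'⟩,
          SimpleGraph.permSubgraph_inv c⟩
  have hverts : (c.support : Set V) = (M.graph.permSubgraph c).verts := by
    ext x
    simp [SimpleGraph.permSubgraph]
  rw [hfib, Finset.sum_pair hinv.symm, permWeight_inv, Equiv.Perm.support_inv, hw, hverts, C_add,
    add_mul]

theorem sum_involutive_cyclePerm (D : Set V → ℂ[X]) (u : V) :
    ∑ c : Equiv.Perm V with (c.IsCycle ∧ c u ≠ u) ∧ c⁻¹ = c,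
        C (M.permWeight c) * D (c.support : Set V)
      = ∑ v ∈ M.neighbours u, D {v, u} := by
  have h1 : ∑ v ∈ M.neighbours u, D {v, u}
      = ∑ v ∈ Finset.univ.erase u, if M.graph.Adj u v then D {v, u} else 0 := by
    rw [← Finset.sum_filter]
    refine Finset.sum_congr ?_ fun _ _ => rfl
    ext v
    simp only [neighbours, Set.Finite.mem_toFinset, Set.mem_ofPred_eq, Finset.mem_filter,
      Finset.mem_erase, Finset.mem_univ, and_true]
    exact ⟨fun h => ⟨h.ne', h⟩, fun h => h.2⟩
  rw [h1]
  symm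
  refine Finset.sum_bij (fun v _ => Equiv.swap u v) ?_ ?_ ?_ ?_
  · intro v hv
    have hv' : v ≠ u := by simpa using hv
    simp [Equiv.Perm.isCycle_swap hv'.symm, hv']
  · intro v _ w _ h
    simpa using congrArg (· u) h
  · intro c hc
    obtain ⟨⟨hc1, hc2⟩, hc3⟩ := (Finset.mem_filter.1 hc).2
    refine ⟨c u, by simpa using hc2, (hc1.eq_swap_of_apply_apply_eq_self hc2 ?_).symm⟩
    exact (Equiv.Perm.inv_eq_iff_eq.1 (by rw [hc3])).symm
  · intro v hv
    have hv' : u ≠ v := by simpa [eq_comm] using hv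
    have hw : M.permWeight (Equiv.swap u v) = M.nMatrix u v * M.nMatrix v u := by
      rw [permWeight, Equiv.Perm.support_swap hv', Finset.prod_pair hv']
      simp
    rw [hw, Equiv.Perm.support_swap hv']
    split_ifs with h
    · simp [M.nMatrix_mul_symm h, Set.pair_comm]
    · simp [M.nMatrix_eq_zero h]

theorem charPoly_eq_sum_cyclePerm (u : V) :
    M.charPoly = X * complMinor M.nMatrix.charmatrix {u}
      - ∑ v ∈ M.neighbours u, complMinor M.nMatrix.charmatrix {v, u}
      - ∑ c : Equiv.Perm V with c.IsCycle ∧ c⁻¹ ≠ c ∧ c u ≠ u,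
          C (M.permWeight c) * complMinor M.nMatrix.charmatrix (c.support : Set V) := by
  have h0 : M.charPoly = M.nMatrix.charmatrix.det := by
    unfold charPoly Matrix.charpoly
    congr!
  -- The sign of a cycle is `-(-1)^l` with `l` the size of its support, and the off-diagonal entries
  -- contribute another `(-1)^l`.
  have hterm : ∀ c : Equiv.Perm V, c.IsCycle →
      ((Equiv.Perm.sign c : ℤ) : ℂ[X]) * ∏ i ∈ c.support, M.nMatrix.charmatrix i (c i)
        = - C (M.permWeight c) := by
    intro c hc
    have : ∏ i ∈ c.support, M.nMatrix.charmatrix i (c i)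
        = ∏ i ∈ c.support, (-1) * C (M.nMatrix i (c i)) := by
      refine Finset.prod_congr rfl fun i hi => ?_
      rw [Matrix.charmatrix_apply_ne _ _ _ (Equiv.Perm.mem_support.1 hi).symm, neg_one_mul]
    rw [this, Finset.prod_mul_distrib, Finset.prod_const, hc.sign, permWeight, map_prod]
    push_cast
    rw [← mul_assoc, neg_mul, ← mul_pow]
    simp
  rw [← M.sum_involutive_cyclePerm (fun S => complMinor M.nMatrix.charmatrix S) u, h0,
    det_eq_sum_cycles _ u, Matrix.charmatrix_apply_eq, M.nMatrix_eq_zero M.graph.irrefl, C_0,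
    sub_zero, sub_sub, sub_eq_add_neg,
    ← Finset.filter_filter (fun c : Equiv.Perm V => c.IsCycle ∧ c u ≠ u)]
  congr 1
  have hset : ({c : Equiv.Perm V | c.IsCycle ∧ c⁻¹ ≠ c ∧ c u ≠ u} : Finset (Equiv.Perm V))
      = Finset.filter (fun c => ¬ c⁻¹ = c)
        ({c : Equiv.Perm V | c.IsCycle ∧ c u ≠ u} : Finset (Equiv.Perm V)) := by
    ext c
    simp only [Finset.mem_filter, Finset.mem_univ, true_and]
    tauto
  rw [hset, Finset.sum_filter_add_sum_filter_not, ← Finset.sum_neg_distrib]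
  refine Finset.sum_congr rfl fun c hc => ?_
  rw [hterm c (Finset.mem_filter.1 hc).2.1, neg_mul]

/-! ### Deleting an edge -/

theorem permWeight_deleteEdge (u v : V) (huv : u ≠ v) (c : Equiv.Perm V) :
    (M.deleteEdge u v).permWeight c = if c u = v ∨ c v = u then 0 else M.permWeight c := by
  split_ifs with h
  · rcases h with h | h
    · refine Finset.prod_eq_zero (i := u) ?_ ?_
      · rw [Equiv.Perm.mem_support, h]
        exact huv.symm
      · simp [nMatrix_deleteEdge, h]
    · refine Finset.prod_eq_zero (i := v) ?_ ?_
      · rw [Equiv.Perm.mem_support, h]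
        exact huv
      · simp [nMatrix_deleteEdge, h]
  · refine Finset.prod_congr rfl fun x _ => ?_
    rw [nMatrix_deleteEdge, if_neg]
    intro h'
    rcases Sym2.eq_iff.1 h' with ⟨rfl, hc⟩ | ⟨rfl, hc⟩
    · exact h (Or.inl hc)
    · exact h (Or.inr hc)

/-- The only entries changed lie in the row or column of `u`, which the minor omits. -/
theorem complMinor_deleteEdge (u v : V) {S : Set V} (hu : u ∈ S) :
    complMinor (M.deleteEdge u v).nMatrix.charmatrix S = complMinor M.nMatrix.charmatrix S := by
  unfold complMinor
  congr 1
  ext1 ⟨i, hi⟩ ⟨j, hj⟩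
  have hi' : i ≠ u := fun h => hi (h ▸ hu)
  have hj' : j ≠ u := fun h => hj (h ▸ hu)
  have : s(i, j) ≠ s(u, v) := fun h => by
    rcases Sym2.eq_iff.1 h with ⟨h, -⟩ | ⟨-, h⟩
    · exact hi' h
    · exact hj' h
  simp only [Matrix.submatrix_apply, Matrix.charmatrix_apply, nMatrix_deleteEdge, this, if_false]

theorem charPoly_eq_deleteEdge {u v : V} (huv : M.graph.Adj u v) :
    M.charPoly = (M.deleteEdge u v).charPoly - complMinor M.nMatrix.charmatrix {v, u}
      - ∑ c : Equiv.Perm V with c.IsCycle ∧ c⁻¹ ≠ c ∧ (c u = v ∨ c v = u),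
          C (M.permWeight c) * complMinor M.nMatrix.charmatrix (c.support : Set V) := by
  have hn : M.neighbours u = insert v ((M.deleteEdge u v).neighbours u) := by
    ext w
    by_cases hw : w = v
    · simp [neighbours, hw, huv]
    · simp [neighbours, hw, deleteEdge, huv.ne]
  have hv : v ∉ (M.deleteEdge u v).neighbours u := by simp [neighbours, deleteEdge]
  -- Cycles through `u` split into those using `uv`, whose weight vanishes in `M - uv`, and the
  -- others, whose weight is unchanged.
  have hsum : ∑ c : Equiv.Perm V with c.IsCycle ∧ c⁻¹ ≠ c ∧ c u ≠ u,
        C (M.permWeight c) * complMinor M.nMatrix.charmatrix (c.support : Set V)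
      = ∑ c : Equiv.Perm V with c.IsCycle ∧ c⁻¹ ≠ c ∧ (c u = v ∨ c v = u),
          C (M.permWeight c) * complMinor M.nMatrix.charmatrix (c.support : Set V)
        + ∑ c : Equiv.Perm V with c.IsCycle ∧ c⁻¹ ≠ c ∧ c u ≠ u,
          C ((M.deleteEdge u v).permWeight c) *
            complMinor M.nMatrix.charmatrix (c.support : Set V) := by
    rw [Finset.sum_filter, Finset.sum_filter, Finset.sum_filter, ← Finset.sum_add_distrib]
    refine Finset.sum_congr rfl fun c _ => ?_
    rw [M.permWeight_deleteEdge u v huv.ne]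
    by_cases h : c u = v ∨ c v = u
    · have hcu : c u ≠ u := by
        rcases h with h | h
        · exact fun h' => huv.ne (h'.symm.trans h)
        · exact fun h' => huv.ne (c.injective (h'.trans h.symm))
      simp [h, hcu]
    · simp [h]
  have hsum' : ∑ c : Equiv.Perm V with c.IsCycle ∧ c⁻¹ ≠ c ∧ c u ≠ u,
        C ((M.deleteEdge u v).permWeight c) *
          complMinor (M.deleteEdge u v).nMatrix.charmatrix (c.support : Set V)
      = ∑ c : Equiv.Perm V with c.IsCycle ∧ c⁻¹ ≠ c ∧ c u ≠ u,
          C ((M.deleteEdge u v).permWeight c) *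
            complMinor M.nMatrix.charmatrix (c.support : Set V) := by
    refine Finset.sum_congr rfl fun c hc => ?_
    rw [M.complMinor_deleteEdge u v (by simpa using (Finset.mem_filter.1 hc).2.2.2)]
  rw [M.charPoly_eq_sum_cyclePerm u, (M.deleteEdge u v).charPoly_eq_sum_cyclePerm u, hn,
    Finset.sum_insert hv, hsum, hsum', M.complMinor_deleteEdge u v (by simp),
    Finset.sum_congr rfl fun w _ => M.complMinor_deleteEdge u v (S := {w, u}) (by simp)]
  ring

end MixedGraph

theorem mainTheorem12 {V : Type*} [Finite V] (M : MixedGraph V)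
    (wt : M.graph.Subgraph → ℂ)
    (hwt : ∀ Z : M.graph.Subgraph, M.IsMixedCycle Z → M.IsWeight Z (wt Z)) :
    (∀ u : V,
      M.charPoly = X * (M.deleteVerts {u}).charPoly
        - ∑ v ∈ M.neighbours u, (M.deleteVerts {v, u}).charPoly
        - ∑ Z ∈ M.cyclesAt u, C (wt Z + conj (wt Z)) * (M.deleteVerts Z.verts).charPoly) ∧
    (∀ u v : V, M.graph.Adj u v →
      M.charPoly = (M.deleteEdge u v).charPoly
        - (M.deleteVerts {v, u}).charPoly
        - ∑ Z ∈ M.cyclesThrough u v,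
            C (wt Z + conj (wt Z)) * (M.deleteVerts Z.verts).charPoly) := by
  classical
  have := Fintype.ofFinite V
  simp only [MixedGraph.charPoly_deleteVerts]
  constructor
  · intro u
    rw [← M.sum_cyclePerm_eq_sum_mixedCycle wt hwt (complMinor M.nMatrix.charmatrix)
      (M.cyclesAt u) (fun Z => u ∈ Z.verts) (by simp [MixedGraph.cyclesAt]) (fun c => c u ≠ u)
      (fun _ _ => Iff.rfl)]
    convert M.charPoly_eq_sum_cyclePerm u
  · intro u v huv
    rw [← M.sum_cyclePerm_eq_sum_mixedCycle wt hwt (complMinor M.nMatrix.charmatrix)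
      (M.cyclesThrough u v) (fun Z => Z.Adj u v) (by simp [MixedGraph.cyclesThrough])
      (fun c => c u = v ∨ c v = u) (fun _ _ => (and_iff_right huv).symm)]
    convert M.charPoly_eq_deleteEdge huv
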